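/- Let $\lambda>0$ and consider the pure birth (Yule) tree with rate $\lambda$: at time $0$ the tree consists of a single root, which is its only leaf; each leaf, after an exponentially distributed lifetime with mean $1/\lambda$, independent of everything else, creates two new leaves as its children and ceases to be a leaf. The depth of a leaf is the number of edges between it and the root. Let $Z(t)$ be the number of leaves at time $t$ and $G(t)$ the sum of the depths of the leaves at time $t$. Then, for every $t\ge 0$, almost surely the set of leaves at time $t$ is finite and non-empty, the average leaf depth $G(t)/Z(t)$ is square-integrable, and $$\lim_{t\to\infty}\operatorname{Var}\!\left(\frac{G(t)}{Z(t)}\right)=7,$$ whatever the value of $\lambda$. -/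

import Mathlib

open MeasureTheory ProbabilityTheory Filter Topology

/-- Vertices of the full binary tree are coded by finite words over `Bool`: the root is `[]` and the
two children of `u` are `false :: u` and `true :: u`, so that the depth of `u` (its number of edges
to the root) is `u.length`. Given the lifetimes `T`, where `T u` is the time `u` spends as a leaf
before it is replaced by its two children, this is the time at which `u` appears in the tree. -/
def YuleTree.birthTime (T : List Bool → ℝ) : List Bool → ℝ
  | [] => 0
  | _ :: u => YuleTree.birthTime T u + T u

/-- The leaves of the tree at time `t`: the vertices that have appeared by time `t` and have not
yet branched. -/
def YuleTree.leaves (T : List Bool → ℝ) (t : ℝ) : Set (List Bool) :=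
  {u | YuleTree.birthTime T u ≤ t ∧ t < YuleTree.birthTime T u + T u}

/-- `Z(t)`, the number of leaves at time `t`. -/
noncomputable def YuleTree.Z (T : List Bool → ℝ) (t : ℝ) : ℕ :=
  (YuleTree.leaves T t).ncard

/-- `G(t)`, the sum of the depths of the leaves at time `t`. -/
noncomputable def YuleTree.G (T : List Bool → ℝ) (t : ℝ) : ℕ :=
  ∑ᶠ u ∈ YuleTree.leaves T t, u.length

/-- `T` is a family of independent exponentially distributed lifetimes with rate `lam`
(mean `1 / lam`), one for each vertex. -/
structure YuleTree.IsLifetimes {Ω : Type*} [MeasurableSpace Ω] (lam : ℝ)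
    (T : List Bool → Ω → ℝ) (μ : Measure Ω) : Prop where
  hasLaw : ∀ u, HasLaw (T u) (expMeasure lam) μ
  indep : iIndepFun T μ

/-!
The tree at time `t` has a given finite shape `τ` with `n` internal nodes with probability
`w τ * p * (1 - p) ^ n`, where `p = exp (-lam * t)` and `w τ` is the product over the internal
nodes of `τ` of the inverse of the number of internal nodes of the subtree above that node
(`YuleTree.lifetimeMeasure_hasShape`). This follows by induction on `τ` from the independence of
the lifetime of the root and the two families of lifetimes above its children
(`YuleTree.map_lifetimeMeasure`). The weights of the shapes with `n` internal nodes sum up to `1`,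
so that the probabilities of the finite shapes sum up to `1` as well: the tree is almost surely
finite, its number `k` of leaves is geometric with parameter `p`, and given `k` the tree is a random
binary search tree.

For a random binary search tree with `k` leaves, splitting at the root gives recursions for the
first two moments of the sum of the depths. The second one involves a convolution of harmonic
numbers, which is computed by multiplying generating functions. With `H` the harmonic number of
index `k` and `D = 2 * ∑ 1 / (i * j)` over `1 ≤ i < j ≤ k`, the average depth has mean `2 * H - 2`
and second moment `11 + 4 * D - 8 * H - (1 + 2 * H) / k` (`YuleTree.sum_weight_mul_pathLength`,
`YuleTree.sum_weight_mul_pathLength_sq`).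

Averaging over the geometric law of `k` uses `∑ H x ^ k = y / (1 - x)` and
`∑ D x ^ k = y ^ 2 / (1 - x)`, where `x = 1 - p` and `y = -log p = lam * t`. The mean is
`2 * y / x - 2`, and the second moment is `11 + 4 * y ^ 2 / x - 8 * y / x` up to an error of order
`p * y ^ 2`. Subtracting the square of the mean, the terms in `y` cancel and those in `y ^ 2` leave
`-4 * p * y ^ 2 / x ^ 2`. Hence the variance is `7 + O(p * y ^ 2)`, which tends to `7`.
-/

namespace YuleTree

open Finset.HasAntidiagonal (antidiagonal)

/-! ### Harmonic numbers and their convolutions -/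

/-- The sum `∑ 2 / (i j)` over `1 ≤ i < j ≤ n`, that is `H n ^ 2` minus the sum of the first `n`
inverse squares. -/
noncomputable def pairHarmonic (n : ℕ) : ℝ :=
  ∑ i ∈ Finset.range n, 2 * (harmonic i : ℝ) / (i + 1)

lemma pairHarmonic_zero : pairHarmonic 0 = 0 := by simp [pairHarmonic]

lemma pairHarmonic_succ (n : ℕ) :
    pairHarmonic (n + 1) = pairHarmonic n + 2 * (harmonic n : ℝ) / (n + 1) :=
  Finset.sum_range_succ _ _

lemma cast_harmonic_succ (n : ℕ) :
    (harmonic (n + 1) : ℝ) = (harmonic n : ℝ) + 1 / (n + 1) := by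
  rw [harmonic_succ]; push_cast; ring

lemma sum_antidiagonal_inv (n : ℕ) :
    ∑ p ∈ antidiagonal n, (1 : ℝ) / (p.1 + 1) = (harmonic (n + 1) : ℝ) := by
  rw [Finset.Nat.sum_antidiagonal_eq_sum_range_succ_mk]
  simp [harmonic]

/-- By partial fractions, `1 / ((i + 1) (j + 1))` is the average of `1 / (i + 1)` and
`1 / (j + 1)` up to a factor depending on `i + j` only. -/
lemma sum_antidiagonal_inv_mul_inv (n : ℕ) :
    ∑ p ∈ antidiagonal n, (1 : ℝ) / (p.1 + 1) * (1 / (p.2 + 1))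
      = 2 * (harmonic (n + 1) : ℝ) / (n + 2) := by
  have h : ∀ p ∈ antidiagonal n, (1 : ℝ) / (p.1 + 1) * (1 / (p.2 + 1))
      = (1 / (p.1 + 1) + 1 / (p.2 + 1)) / (n + 2) := by
    intro p hp
    rw [Finset.HasAntidiagonal.mem_antidiagonal] at hp
    subst hp
    push_cast
    have : (p.1 : ℝ) + p.2 + 2 ≠ 0 := by positivity
    field_simp
    ring
  have hswap : ∑ p ∈ antidiagonal n, (1 : ℝ) / (p.2 + 1) = (harmonic (n + 1) : ℝ) := by
    rw [← sum_antidiagonal_inv, ← Finset.Nat.sum_antidiagonal_swap]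
    simp only [Prod.snd_swap]
  rw [Finset.sum_congr rfl h, ← Finset.sum_div, Finset.sum_add_distrib, sum_antidiagonal_inv, hswap,
    two_mul]

open PowerSeries in
lemma one_sub_X_mul_mk {a b : ℕ → ℝ} (h0 : a 0 = b 0) (h : ∀ n, a (n + 1) = a n + b (n + 1)) :
    (1 - X) * mk a = mk b := by
  ext n
  cases n with
  | zero => simp [sub_mul, h0]
  | succ n => simp [sub_mul, coeff_succ_X_mul, h]

open PowerSeries in
/-- The generating function of `(n + 1) (H (n + 1) - 1)` is `-log (1 - x) / (1 - x) ^ 2`. Its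
square is found by applying `1 / (1 - x)`, which takes partial sums of the coefficients, four times
to the square of `-log (1 - x)`. -/
lemma sum_antidiagonal_harmonic_mul_harmonic (n : ℕ) :
    ∑ p ∈ antidiagonal n, (((p.1 : ℝ) + 1) * (harmonic (p.1 + 1) - 1)) *
        (((p.2 : ℝ) + 1) * (harmonic (p.2 + 1) - 1))
      = (n + 1) * (n + 2) * (n + 3) / 6 * (pairHarmonic (n + 3)
          - 11 / 3 * (harmonic (n + 3) : ℝ) + 85 / 18) := by
  set u : ℕ → ℝ := fun n => (n + 1) * (harmonic (n + 1) - 1) with hu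
  have hU : (1 - X) * ((1 - X) * mk u) = X * mk (fun n : ℕ => (1 : ℝ) / (n + 1)) := by
    have h1 : (1 - X) * mk u = mk (fun n => (harmonic n : ℝ)) := by
      refine one_sub_X_mul_mk (by simp [hu]) fun n => ?_
      simp only [hu, cast_harmonic_succ]
      push_cast
      field_simp
      ring
    rw [h1]
    have h2 : X * mk (fun n : ℕ => (1 : ℝ) / (n + 1)) = mk (fun n : ℕ => (1 : ℝ) / n) := by
      ext n
      cases n <;> simp [coeff_succ_X_mul]
    rw [h2]
    refine one_sub_X_mul_mk (by simp) fun n => ?_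
    rw [cast_harmonic_succ]
    push_cast
    ring
  have hL : (X * mk (fun n : ℕ => (1 : ℝ) / (n + 1))) * (X * mk (fun n : ℕ => (1 : ℝ) / (n + 1)))
      = mk (fun n : ℕ => 2 * (harmonic (n - 1) : ℝ) / n) := by
    rw [mul_mul_mul_comm, mul_assoc]
    ext n
    rcases n with _ | _ | n
    · simp
    · simp [coeff_succ_X_mul]
    · rw [coeff_succ_X_mul, coeff_succ_X_mul, coeff_mul, coeff_mk]
      simp only [coeff_mk, sum_antidiagonal_inv_mul_inv, add_tsub_cancel_right]
      push_cast
      ring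
  have hC1 : (1 - X) * mk pairHarmonic = mk (fun n : ℕ => 2 * (harmonic (n - 1) : ℝ) / n) := by
    refine one_sub_X_mul_mk (by simp [pairHarmonic_zero]) fun n => ?_
    rw [pairHarmonic_succ]
    simp
  have hC2 : (1 - X) * mk (fun n : ℕ => ((n : ℝ) + 1) * (pairHarmonic (n + 1)
      - 2 * (harmonic (n + 1) : ℝ) + 2)) = mk pairHarmonic := by
    refine one_sub_X_mul_mk (by simp [pairHarmonic_succ, pairHarmonic_zero]) fun n => ?_
    simp only [pairHarmonic_succ, cast_harmonic_succ]
    push_cast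
    field_simp
    ring
  have hC3 : (1 - X) * mk (fun n : ℕ => ((n : ℝ) + 1) * (n + 2) / 2 * (pairHarmonic (n + 2)
      - 3 * (harmonic (n + 2) : ℝ) + 7 / 2)) = mk (fun n : ℕ => ((n : ℝ) + 1) *
        (pairHarmonic (n + 1) - 2 * (harmonic (n + 1) : ℝ) + 2)) := by
    refine one_sub_X_mul_mk ?_ fun n => ?_
    · simp [pairHarmonic_succ, pairHarmonic_zero]
      norm_num
    simp only [pairHarmonic_succ, cast_harmonic_succ]
    push_cast
    field_simp
    ring
  have hC4 : (1 - X) * mk (fun n : ℕ => ((n : ℝ) + 1) * (n + 2) * (n + 3) / 6 *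
      (pairHarmonic (n + 3) - 11 / 3 * (harmonic (n + 3) : ℝ) + 85 / 18)) =
        mk (fun n : ℕ => ((n : ℝ) + 1) * (n + 2) / 2 * (pairHarmonic (n + 2)
      - 3 * (harmonic (n + 2) : ℝ) + 7 / 2)) := by
    refine one_sub_X_mul_mk ?_ fun n => ?_
    · simp [pairHarmonic_succ, pairHarmonic_zero]
      norm_num
    simp only [pairHarmonic_succ, cast_harmonic_succ]
    push_cast
    field_simp
    ring
  have hne : (1 - X : PowerSeries ℝ) ≠ 0 := by
    intro h
    simpa using congrArg (coeff 0) h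
  have key : mk u * mk u = mk (fun n : ℕ => ((n : ℝ) + 1) * (n + 2) * (n + 3) / 6 *
      (pairHarmonic (n + 3) - 11 / 3 * (harmonic (n + 3) : ℝ) + 85 / 18)) := by
    refine mul_left_cancel₀ (pow_ne_zero 4 hne) ?_
    calc (1 - X) ^ 4 * (mk u * mk u)
        = ((1 - X) * ((1 - X) * mk u)) * ((1 - X) * ((1 - X) * mk u)) := by ring
      _ = (1 - X) * ((1 - X) * ((1 - X) * ((1 - X) * mk (fun n : ℕ => ((n : ℝ) + 1) * (n + 2) *
            (n + 3) / 6 * (pairHarmonic (n + 3) - 11 / 3 * (harmonic (n + 3) : ℝ) + 85 / 18))))) := by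
          rw [hU, hL, hC4, hC3, hC2, hC1]
      _ = _ := by ring
  simpa only [coeff_mul, coeff_mk] using congrArg (coeff n) key

/-! ### Random binary search trees -/

open BinaryTree

/-- The sum of the depths of the leaves of a binary tree. -/
def pathLength : BinaryTree Unit → ℕ
  | .nil => 0
  | .node _ l r => pathLength l + pathLength r + (l.numLeaves + r.numLeaves)

/-- The probability of a shape among the shapes with the same number of internal nodes, when the
number of internal nodes in the left subtree of each node is uniform: this is the law of the
shape obtained by repeatedly splitting a uniformly chosen leaf. -/
noncomputable def weight : BinaryTree Unit → ℝ
  | .nil => 1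
  | .node _ l r => weight l * weight r / (l.numNodes + r.numNodes + 1)

lemma weight_nonneg : ∀ τ, 0 ≤ weight τ
  | .nil => by simp [weight]
  | .node _ l r => by
    have := weight_nonneg l
    have := weight_nonneg r
    rw [weight]
    positivity

lemma sum_treesOfNumNodesEq_succ (n : ℕ) (f : BinaryTree Unit → ℝ) :
    ∑ τ ∈ treesOfNumNodesEq (n + 1), f τ = ∑ p ∈ antidiagonal n,
      ∑ l ∈ treesOfNumNodesEq p.1, ∑ r ∈ treesOfNumNodesEq p.2, f (.node () l r) := by
  rw [treesOfNumNodesEq_succ, Finset.sum_biUnion]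
  · refine Finset.sum_congr rfl fun p _ => ?_
    rw [pairwiseNode, Finset.sum_map, Finset.sum_product]
    rfl
  · intro p _ q _ hpq
    rw [Function.onFun, Finset.disjoint_left]
    intro τ hτ hτ'
    simp only [pairwiseNode, Finset.mem_map, Finset.mem_product, mem_treesOfNumNodesEq,
      Prod.exists] at hτ hτ'
    obtain ⟨l, r, ⟨hl, hr⟩, rfl⟩ := hτ
    obtain ⟨l', r', ⟨hl', hr'⟩, h⟩ := hτ'
    cases h
    exact hpq (Prod.ext (hl.symm.trans hl') (hr.symm.trans hr'))

lemma sum_sum_weight_mul (i j : ℕ) (f g : BinaryTree Unit → ℝ) :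
    ∑ l ∈ treesOfNumNodesEq i, ∑ r ∈ treesOfNumNodesEq j, weight l * weight r * (f l * g r)
      = (∑ l ∈ treesOfNumNodesEq i, weight l * f l) *
        ∑ r ∈ treesOfNumNodesEq j, weight r * g r := by
  rw [Finset.sum_mul_sum]
  exact Finset.sum_congr rfl fun l _ => Finset.sum_congr rfl fun r _ => by ring

lemma sum_weight_mul_succ (n : ℕ) (f : BinaryTree Unit → ℝ) :
    ∑ τ ∈ treesOfNumNodesEq (n + 1), weight τ * f τ = (∑ p ∈ antidiagonal n,
      ∑ l ∈ treesOfNumNodesEq p.1, ∑ r ∈ treesOfNumNodesEq p.2,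
        weight l * weight r * f (.node () l r)) / (n + 1) := by
  simp_rw [sum_treesOfNumNodesEq_succ, Finset.sum_div]
  refine Finset.sum_congr rfl fun p hp => Finset.sum_congr rfl fun l hl =>
    Finset.sum_congr rfl fun r hr => ?_
  rw [mem_treesOfNumNodesEq] at hl hr
  rw [weight, hl, hr, ← Finset.HasAntidiagonal.mem_antidiagonal.1 hp]
  push_cast
  ring

lemma sum_weight (n : ℕ) : ∑ τ ∈ treesOfNumNodesEq n, weight τ = 1 := by
  induction n using Nat.strong_induction_on with
  | _ n ih =>
    cases n with
    | zero => simp [weight]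
    | succ n =>
      have h := sum_weight_mul_succ n fun _ => 1
      simp only [mul_one] at h
      have h' : ∀ p ∈ antidiagonal n, ∑ l ∈ treesOfNumNodesEq p.1,
          ∑ r ∈ treesOfNumNodesEq p.2, weight l * weight r = 1 := by
        intro p hp
        have hp' := Finset.HasAntidiagonal.mem_antidiagonal.1 hp
        rw [← Finset.sum_mul_sum, ih _ (by omega), ih _ (by omega), one_mul]
      rw [h, Finset.sum_congr rfl h']
      have : (n : ℝ) + 1 ≠ 0 := by positivity
      simp [this]

lemma pathLength_node {n : ℕ} {p : ℕ × ℕ} (hp : p ∈ antidiagonal n) {l r : BinaryTree Unit}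
    (hl : l ∈ treesOfNumNodesEq p.1) (hr : r ∈ treesOfNumNodesEq p.2) :
    (pathLength (.node () l r) : ℝ) = pathLength l + pathLength r + (n + 2) := by
  rw [mem_treesOfNumNodesEq] at hl hr
  rw [pathLength, numLeaves_eq_numNodes_succ, numLeaves_eq_numNodes_succ, hl, hr,
    ← Finset.HasAntidiagonal.mem_antidiagonal.1 hp]
  push_cast
  ring

lemma sum_antidiagonal_add {n : ℕ} (f : ℕ → ℝ) :
    ∑ p ∈ antidiagonal n, (f p.1 + f p.2) = 2 * ∑ i ∈ Finset.range (n + 1), f i := by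
  have h1 : ∑ p ∈ antidiagonal n, f p.1 = ∑ i ∈ Finset.range (n + 1), f i := by
    rw [Finset.Nat.sum_antidiagonal_eq_sum_range_succ_mk]
  have h2 : ∑ p ∈ antidiagonal n, f p.2 = ∑ i ∈ Finset.range (n + 1), f i := by
    rw [← h1, ← Finset.Nat.sum_antidiagonal_swap]
    simp only [Prod.snd_swap]
  rw [Finset.sum_add_distrib, h1, h2, two_mul]

lemma sum_range_mul_harmonic (n : ℕ) :
    ∑ i ∈ Finset.range (n + 1), ((i : ℝ) + 1) * ((harmonic (i + 1) : ℝ) - 1)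
      = (n + 1) * (n + 2) / 2 * ((harmonic (n + 2) : ℝ) - 3 / 2) := by
  induction n with
  | zero => simp; norm_num
  | succ n ih =>
    rw [Finset.sum_range_succ, ih]
    simp only [cast_harmonic_succ]
    push_cast
    field_simp
    ring

/-- Mean of the path length of a random binary search tree. -/
lemma sum_weight_mul_pathLength (n : ℕ) :
    ∑ τ ∈ treesOfNumNodesEq n, weight τ * pathLength τ
      = 2 * ((n + 1) * ((harmonic (n + 1) : ℝ) - 1)) := by
  induction n using Nat.strong_induction_on with
  | _ n ih =>
    cases n with
    | zero => simp [weight, pathLength]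
    | succ n =>
      set m : ℕ → ℝ := fun n => 2 * ((n + 1) * ((harmonic (n + 1) : ℝ) - 1)) with hm
      have h : ∀ p ∈ antidiagonal n, ∑ l ∈ treesOfNumNodesEq p.1, ∑ r ∈ treesOfNumNodesEq p.2,
          weight l * weight r * (pathLength (.node () l r) : ℝ) = m p.1 + m p.2 + (n + 2) := by
        intro p hp
        have hp' := Finset.HasAntidiagonal.mem_antidiagonal.1 hp
        calc _ = ∑ l ∈ treesOfNumNodesEq p.1, ∑ r ∈ treesOfNumNodesEq p.2,
              (weight l * weight r * ((pathLength l : ℝ) * 1)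
                + weight l * weight r * (1 * (pathLength r : ℝ))
                + (n + 2) * (weight l * weight r * (1 * 1))) := by
              refine Finset.sum_congr rfl fun l hl => Finset.sum_congr rfl fun r hr => ?_
              rw [pathLength_node hp hl hr]
              ring
          _ = _ := by
              simp_rw [Finset.sum_add_distrib, ← Finset.mul_sum]
              rw [sum_sum_weight_mul p.1 p.2 (fun l => (pathLength l : ℝ)) (fun _ => 1),
                sum_sum_weight_mul p.1 p.2 (fun _ => 1) (fun r => (pathLength r : ℝ)),
                sum_sum_weight_mul p.1 p.2 (fun _ => 1) (fun _ => 1)]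
              simp only [mul_one, sum_weight, ih _ (by omega : p.1 < n + 1),
                ih _ (by omega : p.2 < n + 1), hm]
              ring
      rw [sum_weight_mul_succ, Finset.sum_congr rfl h, Finset.sum_add_distrib,
        sum_antidiagonal_add, hm, ← Finset.mul_sum, sum_range_mul_harmonic]
      simp only [Finset.sum_const, Finset.Nat.card_antidiagonal, nsmul_eq_mul, cast_harmonic_succ]
      push_cast
      field_simp
      ring

/-- The closed form of the second moment of the path length, in `sum_weight_mul_pathLength_sq`. -/
noncomputable def secondMoment (n : ℕ) : ℝ :=
  (n + 1) ^ 2 * (11 + 4 * pairHarmonic (n + 1) - 8 * (harmonic (n + 1) : ℝ))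
    - (n + 1) * (1 + 2 * (harmonic (n + 1) : ℝ))

lemma secondMoment_succ (n : ℕ) : (n + 1) * secondMoment (n + 1)
    = 2 * ∑ i ∈ Finset.range (n + 1), secondMoment i
      + 2 * (4 * ((n + 1) * (n + 2) * (n + 3) / 6 * (pairHarmonic (n + 3)
          - 11 / 3 * (harmonic (n + 3) : ℝ) + 85 / 18)))
      + 2 * (n + 2) * (4 * ((n + 1) * (n + 2) / 2 * ((harmonic (n + 2) : ℝ) - 3 / 2)))
      + (n + 1) * (n + 2) ^ 2 := by
  induction n with
  | zero =>
    simp [secondMoment, pairHarmonic_succ, pairHarmonic_zero]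
    norm_num
  | succ n ih =>
    rw [Finset.sum_range_succ]
    have h := ih
    rw [← sub_eq_iff_eq_add, ← sub_eq_iff_eq_add, ← sub_eq_iff_eq_add] at h
    rw [mul_add 2, ← h]
    simp only [secondMoment, cast_harmonic_succ, pairHarmonic_succ]
    push_cast
    field_simp
    ring

/-- Second moment of the path length of a random binary search tree. -/
lemma sum_weight_mul_pathLength_sq (n : ℕ) :
    ∑ τ ∈ treesOfNumNodesEq n, weight τ * (pathLength τ : ℝ) ^ 2 = secondMoment n := by
  induction n using Nat.strong_induction_on with
  | _ n ih =>
    cases n with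
    | zero =>
      simp [weight, pathLength, secondMoment, pairHarmonic_succ,
        pairHarmonic_zero]
      norm_num
    | succ n =>
      set m : ℕ → ℝ := fun n => (n + 1) * ((harmonic (n + 1) : ℝ) - 1) with hm
      have h : ∀ p ∈ antidiagonal n, ∑ l ∈ treesOfNumNodesEq p.1, ∑ r ∈ treesOfNumNodesEq p.2,
          weight l * weight r * (pathLength (.node () l r) : ℝ) ^ 2
          = (secondMoment p.1 + secondMoment p.2) + 8 * (m p.1 * m p.2)
            + 4 * (n + 2) * (m p.1 + m p.2) + (n + 2) ^ 2 := by
        intro p hp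
        have hp' := Finset.HasAntidiagonal.mem_antidiagonal.1 hp
        calc _ = ∑ l ∈ treesOfNumNodesEq p.1, ∑ r ∈ treesOfNumNodesEq p.2,
              (weight l * weight r * ((pathLength l : ℝ) ^ 2 * 1)
                + weight l * weight r * (1 * (pathLength r : ℝ) ^ 2)
                + 2 * (weight l * weight r * ((pathLength l : ℝ) * (pathLength r : ℝ)))
                + 2 * (n + 2) * (weight l * weight r * ((pathLength l : ℝ) * 1))
                + 2 * (n + 2) * (weight l * weight r * (1 * (pathLength r : ℝ)))
                + (n + 2) ^ 2 * (weight l * weight r * (1 * 1))) := by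
              refine Finset.sum_congr rfl fun l hl => Finset.sum_congr rfl fun r hr => ?_
              rw [pathLength_node hp hl hr]
              ring
          _ = _ := by
              simp_rw [Finset.sum_add_distrib, ← Finset.mul_sum]
              rw [sum_sum_weight_mul p.1 p.2 (fun l => (pathLength l : ℝ) ^ 2) (fun _ => 1),
                sum_sum_weight_mul p.1 p.2 (fun _ => 1) (fun r => (pathLength r : ℝ) ^ 2),
                sum_sum_weight_mul p.1 p.2 (fun l => (pathLength l : ℝ))
                  (fun r => (pathLength r : ℝ)),
                sum_sum_weight_mul p.1 p.2 (fun l => (pathLength l : ℝ)) (fun _ => 1),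
                sum_sum_weight_mul p.1 p.2 (fun _ => 1) (fun r => (pathLength r : ℝ)),
                sum_sum_weight_mul p.1 p.2 (fun _ => 1) (fun _ => 1)]
              simp only [mul_one, sum_weight, ih _ (by omega : p.1 < n + 1),
                ih _ (by omega : p.2 < n + 1), sum_weight_mul_pathLength, hm]
              ring
      rw [sum_weight_mul_succ, Finset.sum_congr rfl h, Finset.sum_add_distrib,
        Finset.sum_add_distrib, Finset.sum_add_distrib, sum_antidiagonal_add, ← Finset.mul_sum,
        ← Finset.mul_sum, sum_antidiagonal_add, hm, sum_antidiagonal_harmonic_mul_harmonic,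
        sum_range_mul_harmonic, div_eq_iff (by positivity), mul_comm (secondMoment _),
        secondMoment_succ]
      simp only [Finset.sum_const, Finset.Nat.card_antidiagonal, nsmul_eq_mul]
      push_cast
      ring

/-! ### Generating functions of the harmonic numbers -/

lemma harmonic_nonneg (n : ℕ) : (0 : ℝ) ≤ (harmonic n : ℝ) := by
  have : (0 : ℚ) ≤ harmonic n := Finset.sum_nonneg fun _ _ => by positivity
  exact_mod_cast this

lemma hasSum_of_eq {f g : ℕ → ℝ} {a b : ℝ} (h : HasSum f a) (hf : ∀ n, g n = f n) (hb : b = a) :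
    HasSum g b := by
  rwa [funext hf, hb]

lemma hasSum_antidiagonal_mul {a b : ℕ → ℝ} {A B : ℝ} (ha0 : ∀ n, 0 ≤ a n) (hb0 : ∀ n, 0 ≤ b n)
    (ha : HasSum a A) (hb : HasSum b B) :
    HasSum (fun n => ∑ p ∈ antidiagonal n, a p.1 * b p.2) (A * B) := by
  have ha' : Summable fun n => ‖a n‖ := by
    simpa only [Real.norm_eq_abs, abs_of_nonneg (ha0 _)] using ha.summable
  have hb' : Summable fun n => ‖b n‖ := by
    simpa only [Real.norm_eq_abs, abs_of_nonneg (hb0 _)] using hb.summable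
  have h := (summable_norm_sum_mul_antidiagonal_of_summable_norm ha' hb').of_norm.hasSum
  rwa [← tsum_mul_tsum_eq_tsum_sum_antidiagonal_of_summable_norm ha' hb', ha.tsum_eq,
    hb.tsum_eq] at h

section

variable {x : ℝ}

lemma hasSum_log (h0 : 0 ≤ x) (h1 : x < 1) :
    HasSum (fun n : ℕ => x ^ (n + 1) * (1 / ((n : ℝ) + 1))) (-Real.log (1 - x)) := by
  simpa only [mul_one_div] using
    Real.hasSum_pow_div_log_of_abs_lt_one (abs_lt.2 ⟨by linarith, h1⟩)

lemma hasSum_harmonic (h0 : 0 ≤ x) (h1 : x < 1) :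
    HasSum (fun n : ℕ => x ^ (n + 1) * (harmonic (n + 1) : ℝ)) (-Real.log (1 - x) / (1 - x)) := by
  have h := hasSum_antidiagonal_mul (fun n => by positivity) (fun n => by positivity)
    (hasSum_log h0 h1) (hasSum_geometric_of_lt_one h0 h1)
  refine hasSum_of_eq h (fun n => ?_) (div_eq_mul_inv _ _)
  rw [← sum_antidiagonal_inv, Finset.mul_sum]
  refine Finset.sum_congr rfl fun p hp => ?_
  rw [← Finset.HasAntidiagonal.mem_antidiagonal.1 hp]
  ring

lemma hasSum_log_sq (h0 : 0 ≤ x) (h1 : x < 1) :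
    HasSum (fun n : ℕ => x ^ (n + 2) * (2 * (harmonic (n + 1) : ℝ) / (n + 2)))
      (Real.log (1 - x) ^ 2) := by
  have h := hasSum_antidiagonal_mul (fun n => by positivity) (fun n => by positivity)
    (hasSum_log h0 h1) (hasSum_log h0 h1)
  rw [neg_mul_neg, ← sq] at h
  refine hasSum_of_eq h (fun n => ?_) rfl
  rw [← sum_antidiagonal_inv_mul_inv, Finset.mul_sum]
  refine Finset.sum_congr rfl fun p hp => ?_
  rw [← Finset.HasAntidiagonal.mem_antidiagonal.1 hp]
  ring

lemma hasSum_pairHarmonic (h0 : 0 ≤ x) (h1 : x < 1) :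
    HasSum (fun n : ℕ => x ^ (n + 1) * pairHarmonic (n + 1))
      (Real.log (1 - x) ^ 2 / (1 - x)) := by
  have h := hasSum_antidiagonal_mul (fun n => ?_) (fun n => by positivity)
    (hasSum_log_sq h0 h1) (hasSum_geometric_of_lt_one h0 h1)
  swap
  · have := harmonic_nonneg (n + 1)
    positivity
  rw [← hasSum_nat_add_iff' 1]
  simp only [Finset.sum_range_one, zero_add, pairHarmonic_succ 0, pairHarmonic_zero, harmonic_zero,
    Rat.cast_zero, mul_zero, zero_div, add_zero, sub_zero]
  refine hasSum_of_eq h (fun n => ?_) (div_eq_mul_inv _ _)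
  rw [Finset.Nat.sum_antidiagonal_eq_sum_range_succ_mk, pairHarmonic, Finset.mul_sum,
    Finset.sum_range_succ']
  simp only [harmonic_zero, Rat.cast_zero, mul_zero, zero_div, add_zero]
  refine Finset.sum_congr rfl fun i hi => ?_
  have : n + 2 = i + 2 + (n - i) := by have := Finset.mem_range.1 hi; omega
  rw [show n + 1 + 1 = n + 2 from rfl, this, pow_add]
  push_cast
  ring

/-- The mean of `(1 + 2 H k) / k` for geometric `k` is negligible as the parameter tends to `0`,
because the series is bounded by a polynomial in `log (1 - x)`. -/
lemma exists_hasSum_harmonic_div (h0 : 0 ≤ x) (h1 : x < 1) :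
    ∃ e, 0 ≤ e ∧ e ≤ Real.log (1 - x) ^ 2 - 3 * Real.log (1 - x) ∧
      HasSum (fun n : ℕ => x ^ (n + 1) * ((1 + 2 * (harmonic (n + 1) : ℝ)) / (n + 1))) e := by
  have hsq : HasSum (fun n : ℕ => x ^ (n + 1) * (2 * (harmonic n : ℝ) / (n + 1)))
      (Real.log (1 - x) ^ 2) := by
    rw [← hasSum_nat_add_iff' 1]
    simp only [Finset.sum_range_one, harmonic_zero, Rat.cast_zero, mul_zero, zero_div, sub_zero]
    refine hasSum_of_eq (hasSum_log_sq h0 h1) (fun n => ?_) rfl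
    push_cast
    ring
  have hbd := hsq.add ((hasSum_log h0 h1).mul_left 3)
  have hnn : ∀ n : ℕ, 0 ≤ x ^ (n + 1) * ((1 + 2 * (harmonic (n + 1) : ℝ)) / (n + 1)) := fun n => by
    have := harmonic_nonneg (n + 1)
    positivity
  have hle : ∀ n : ℕ, x ^ (n + 1) * ((1 + 2 * (harmonic (n + 1) : ℝ)) / (n + 1))
      ≤ x ^ (n + 1) * (2 * (harmonic n : ℝ) / (n + 1))
        + 3 * (x ^ (n + 1) * (1 / ((n : ℝ) + 1))) := fun n => by
    have h2 : (1 : ℝ) / (n + 1) ≤ 1 := by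
      rw [div_le_one (by positivity)]
      linarith [(Nat.cast_nonneg n : (0 : ℝ) ≤ n)]
    calc _ ≤ x ^ (n + 1) * ((2 * (harmonic n : ℝ) + 3) / (n + 1)) := by
          rw [cast_harmonic_succ]
          gcongr ?_ * (?_ / _)
          linarith
      _ = _ := by ring
  have hs := Summable.of_nonneg_of_le hnn hle hbd.summable
  refine ⟨_, tsum_nonneg hnn, ?_, hs.hasSum⟩
  have := hasSum_le hle hs.hasSum hbd
  linarith

/-- Mean of the average leaf depth of a random binary search tree whose number of internal nodes
is geometric. -/
lemma hasSum_mean (h0 : 0 < x) (h1 : x < 1) :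
    HasSum (fun n : ℕ => (1 - x) * x ^ n * (2 * ((harmonic (n + 1) : ℝ) - 1)))
      (2 * (-Real.log (1 - x) / x - 1)) := by
  have hx : 1 - x ≠ 0 := by linarith
  have h := (((hasSum_harmonic h0.le h1).mul_left ((1 - x) / x)).sub
    ((hasSum_geometric_of_lt_one h0.le h1).mul_left (1 - x))).mul_left 2
  refine hasSum_of_eq h (fun n => ?_) ?_
  · field_simp
    ring
  · field_simp

/-- Second moment of the average leaf depth of a random binary search tree whose number of
internal nodes is geometric. -/
lemma exists_hasSum_secondMoment (h0 : 0 < x) (h1 : x < 1) :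
    ∃ e, 0 ≤ e ∧ e ≤ Real.log (1 - x) ^ 2 - 3 * Real.log (1 - x) ∧
      HasSum (fun n : ℕ => (1 - x) * x ^ n * (secondMoment n / (n + 1) ^ 2))
        (11 + 4 * Real.log (1 - x) ^ 2 / x + 8 * Real.log (1 - x) / x - (1 - x) / x * e) := by
  obtain ⟨e, he0, he1, he⟩ := exists_hasSum_harmonic_div h0.le h1
  refine ⟨e, he0, he1, ?_⟩
  have hx : 1 - x ≠ 0 := by linarith
  have h := ((((hasSum_geometric_of_lt_one h0.le h1).mul_left (11 * (1 - x))).add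
    ((hasSum_pairHarmonic h0.le h1).mul_left (4 * ((1 - x) / x)))).sub
    ((hasSum_harmonic h0.le h1).mul_left (8 * ((1 - x) / x)))).sub (he.mul_left ((1 - x) / x))
  refine hasSum_of_eq h (fun n => ?_) ?_
  · rw [secondMoment]
    field_simp
    ring
  · field_simp
    ring

end

/-! ### The first split of the Yule tree -/

/-- The lifetimes in the subtree above the child `[b]` of the root. -/
def childLifetimes (b : Bool) (T : List Bool → ℝ) : List Bool → ℝ :=
  fun u => T (u ++ [b])

/-- The tree at time `t` has the shape `τ`. Defined by recursion on `τ` rather than through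
`leaves`, so that infinitely many vertices need never be looked at. -/
def HasShape : BinaryTree Unit → (List Bool → ℝ) → ℝ → Prop
  | .nil, T, t => t < T []
  | .node _ l r, T, t => T [] ≤ t ∧ HasShape l (childLifetimes false T) (t - T []) ∧
      HasShape r (childLifetimes true T) (t - T [])

lemma HasShape.unique {τ σ : BinaryTree Unit} {T : List Bool → ℝ} {t : ℝ} (hτ : HasShape τ T t)
    (hσ : HasShape σ T t) : τ = σ := by
  induction τ generalizing σ T t with
  | nil =>
    cases σ with
    | nil => rfl
    | node => exact absurd hσ.1 (not_le.2 hτ)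
  | node _ l r ihl ihr =>
    cases σ with
    | nil => exact absurd hτ.1 (not_le.2 hσ)
    | node => rw [ihl hτ.2.1 hσ.2.1, ihr hτ.2.2 hσ.2.2]

lemma birthTime_concat (T : List Bool → ℝ) (u : List Bool) (b : Bool) :
    birthTime T (u ++ [b]) = T [] + birthTime (childLifetimes b T) u := by
  induction u with
  | nil => simp [birthTime]
  | cons a u ih =>
    rw [List.cons_append, birthTime, ih, birthTime, childLifetimes, add_assoc]

lemma birthTime_nonneg {T : List Bool → ℝ} (hT : ∀ u, 0 ≤ T u) : ∀ u, 0 ≤ birthTime T u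
  | [] => le_rfl
  | _ :: u => add_nonneg (birthTime_nonneg hT u) (hT u)

lemma leaves_eq_singleton {T : List Bool → ℝ} (hT : ∀ u, 0 ≤ T u) {t : ℝ} (ht : 0 ≤ t)
    (h : t < T []) : leaves T t = {[]} := by
  ext u
  rcases List.eq_nil_or_concat' u with rfl | ⟨v, b, rfl⟩
  · simp [leaves, birthTime, ht, h]
  · have := birthTime_nonneg (fun u => hT (u ++ [b])) v
    simp only [leaves, birthTime_concat, Set.mem_ofPred_eq, Set.mem_singleton_iff,
      List.append_eq_nil_iff, List.cons_ne_self, and_false, iff_false, not_and]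
    intro h1
    unfold childLifetimes at h1
    linarith

lemma leaves_eq_union {T : List Bool → ℝ} {t : ℝ} (h : T [] ≤ t) : leaves T t =
    (· ++ [false]) '' leaves (childLifetimes false T) (t - T []) ∪
      (· ++ [true]) '' leaves (childLifetimes true T) (t - T []) := by
  have key : ∀ v b, v ++ [b] ∈ leaves T t ↔ v ∈ leaves (childLifetimes b T) (t - T []) := by
    intro v b
    simp only [leaves, birthTime_concat, Set.mem_ofPred_eq, childLifetimes]
    constructor <;> rintro ⟨h1, h2⟩ <;> constructor <;> linarith
  ext u
  rcases List.eq_nil_or_concat' u with rfl | ⟨v, b, rfl⟩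
  · simp [leaves, birthTime, h]
  · rw [key]
    cases b <;> simp

lemma sum_length_concat {s : Set (List Bool)} (hs : s.Finite) (b : Bool) :
    ∑ᶠ u ∈ (· ++ [b]) '' s, u.length = (∑ᶠ u ∈ s, u.length) + s.ncard := by
  rw [finsum_mem_image (List.append_left_injective [b]).injOn]
  simp only [List.length_append, List.length_singleton]
  rw [finsum_mem_add_distrib hs, finsum_one]

/-- On the event that the tree at time `t` has the shape `τ`, the numbers `Z` and `G` are those
of `τ`. -/
lemma HasShape.leaves_eq {τ : BinaryTree Unit} {T : List Bool → ℝ} {t : ℝ} (h : HasShape τ T t)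
    (hT : ∀ u, 0 ≤ T u) (ht : 0 ≤ t) :
    (leaves T t).Finite ∧ Z T t = τ.numLeaves ∧ G T t = pathLength τ := by
  induction τ generalizing T t with
  | nil => simp [Z, G, leaves_eq_singleton hT ht h, pathLength]
  | node _ l r ihl ihr =>
    obtain ⟨h0, hl, hr⟩ := h
    obtain ⟨fl, zl, gl⟩ := ihl hl (fun u => hT _) (sub_nonneg.2 h0)
    obtain ⟨fr, zr, gr⟩ := ihr hr (fun u => hT _) (sub_nonneg.2 h0)
    have hd : Disjoint ((· ++ [false]) '' leaves (childLifetimes false T) (t - T []))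
        ((· ++ [true]) '' leaves (childLifetimes true T) (t - T [])) := by
      rw [Set.disjoint_left]
      rintro _ ⟨u, -, rfl⟩ ⟨v, -, h⟩
      simp at h
    have fl' := fl.image (· ++ [false])
    have fr' := fr.image (· ++ [true])
    rw [Z] at zl zr
    rw [G] at gl gr
    rw [Z, G, leaves_eq_union h0]
    refine ⟨fl'.union fr', ?_, ?_⟩
    · rw [Set.ncard_union_eq hd fl' fr', Set.ncard_image_of_injective _
        (List.append_left_injective _), Set.ncard_image_of_injective _
        (List.append_left_injective _), zl, zr, numLeaves]
    · rw [finsum_mem_union hd fl' fr', sum_length_concat fl, sum_length_concat fr, zl, zr, gl, gr,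
        pathLength]
      ring

lemma measurable_childLifetimes (b : Bool) : Measurable (childLifetimes b) :=
  measurable_pi_iff.2 fun _ => measurable_pi_apply _

lemma measurableSet_hasShape (τ : BinaryTree Unit) :
    MeasurableSet {q : (List Bool → ℝ) × ℝ | HasShape τ q.1 q.2} := by
  induction τ with
  | nil =>
    exact measurableSet_lt measurable_snd ((measurable_pi_apply _).comp measurable_fst)
  | node _ l r ihl ihr =>
    have h0 : Measurable fun q : (List Bool → ℝ) × ℝ => q.1 [] :=
      (measurable_pi_apply _).comp measurable_fst
    have hs (b : Bool) : Measurable fun q : (List Bool → ℝ) × ℝ =>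
        (childLifetimes b q.1, q.2 - q.1 []) :=
      ((measurable_childLifetimes b).comp measurable_fst).prodMk (measurable_snd.sub h0)
    exact (measurableSet_le h0 measurable_snd).inter ((hs false ihl).inter (hs true ihr))

/-! ### Independence of the two subtrees above the root -/

lemma comap_pi_le_iSup {Ω ι α E : Type*} [MeasurableSpace E] (f : ι → Ω → E) (a : α → ι) :
    MeasurableSpace.comap (fun ω i => f (a i) ω) MeasurableSpace.pi
      ≤ ⨆ i ∈ Set.range a, MeasurableSpace.comap (f i) inferInstance := by
  simp only [MeasurableSpace.pi, MeasurableSpace.comap_iSup, MeasurableSpace.comap_comp]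
  exact iSup_le fun i => le_iSup₂_of_le (a i) (Set.mem_range_self i) le_rfl

lemma indepFun_of_disjoint_range {Ω ι α β E : Type*} [MeasurableSpace Ω] [MeasurableSpace E]
    {μ : Measure Ω} {f : ι → Ω → E} (hf : iIndepFun f μ) (hm : ∀ i, Measurable (f i))
    {a : α → ι} {b : β → ι} (h : Disjoint (Set.range a) (Set.range b)) :
    IndepFun (fun ω i => f (a i) ω) (fun ω j => f (b j) ω) μ := by
  rw [IndepFun_iff_Indep]
  exact indep_of_indep_of_le_left (indep_of_indep_of_le_right
    (indep_iSup_of_disjoint (fun i => (hm i).comap_le) hf.iIndep h) (comap_pi_le_iSup f b))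
    (comap_pi_le_iSup f a)

/-- The joint law of independent exponential lifetimes with rate `lam`. -/
noncomputable def lifetimeMeasure (lam : ℝ) : Measure (List Bool → ℝ) :=
  Measure.infinitePi fun _ => expMeasure lam

lemma isProbabilityMeasure_lifetimeMeasure {lam : ℝ} (hlam : 0 < lam) :
    IsProbabilityMeasure (lifetimeMeasure lam) := by
  have := isProbabilityMeasure_expMeasure hlam
  unfold lifetimeMeasure
  infer_instance

/-- The lifetime of the root and the families of lifetimes above its two children are independent,
and both families have the law of the whole family. -/
lemma map_lifetimeMeasure {lam : ℝ} (hlam : 0 < lam) :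
    (lifetimeMeasure lam).map
        (fun T => (T [], childLifetimes false T, childLifetimes true T)) =
      (expMeasure lam).prod ((lifetimeMeasure lam).prod (lifetimeMeasure lam)) := by
  have := isProbabilityMeasure_expMeasure hlam
  have := isProbabilityMeasure_lifetimeMeasure hlam
  have hI : iIndepFun (fun (u : List Bool) (T : List Bool → ℝ) => T u) (lifetimeMeasure lam) :=
    iIndepFun_infinitePi (X := fun _ x => x) fun _ => measurable_id
  have hm (u : List Bool) : Measurable fun T : List Bool → ℝ => T u := measurable_pi_apply u
  have h1 : IndepFun (fun T : List Bool → ℝ => T [])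
      (fun T => (childLifetimes false T, childLifetimes true T)) (lifetimeMeasure lam) := by
    have h := indepFun_of_disjoint_range hI hm (a := fun _ : Unit => [])
      (b := fun p : Bool × List Bool => p.2 ++ [p.1]) (by
        rw [Set.disjoint_left]
        rintro _ ⟨_, rfl⟩ ⟨p, hp⟩
        simp at hp)
    have hφ : Measurable fun g : Unit → ℝ => g () := measurable_pi_apply _
    have hψ : Measurable fun g : Bool × List Bool → ℝ =>
        (fun u => g (false, u), fun u => g (true, u)) := by fun_prop
    exact h.comp hφ hψ
  have h2 : IndepFun (childLifetimes false) (childLifetimes true) (lifetimeMeasure lam) :=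
    indepFun_of_disjoint_range hI hm (by
      rw [Set.disjoint_left]
      rintro _ ⟨u, rfl⟩ ⟨v, hv⟩
      simp at hv)
  have h3 (b : Bool) : (lifetimeMeasure lam).map (childLifetimes b) = lifetimeMeasure lam :=
    Measure.map_infinitePi_infinitePi_of_inj (P := fun _ => expMeasure lam)
      (List.append_left_injective [b])
  have mc := measurable_childLifetimes
  rw [h1.map_prod_eq_prod_map_map (hm []).aemeasurable ((mc _).prodMk (mc _)).aemeasurable,
    h2.map_prod_eq_prod_map_map (mc _).aemeasurable (mc _).aemeasurable, h3, h3]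
  congr 1
  exact Measure.infinitePi_map_eval (fun _ => expMeasure lam) []

/-! ### The law of the shape of the Yule tree -/

lemma lintegral_expMeasure {lam : ℝ} (t : ℝ) {g : ℝ → ℝ} (hg : Measurable g)
    (hg0 : ∀ x ≤ t, 0 ≤ g x) :
    ∫⁻ x in Set.Iic t, ENNReal.ofReal (g x) ∂(expMeasure lam) =
      ∫⁻ x in Set.Icc 0 t, ENNReal.ofReal (lam * Real.exp (-(lam * x)) * g x) := by
  have hm : Measurable (exponentialPDF lam) :=
    (measurable_exponentialPDFReal lam).ennreal_ofReal
  change ∫⁻ x in Set.Iic t, ENNReal.ofReal (g x) ∂(volume.withDensity (exponentialPDF lam)) = _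
  rw [setLIntegral_withDensity_eq_setLIntegral_mul _ hm hg.ennreal_ofReal measurableSet_Iic,
    ← lintegral_indicator measurableSet_Iic, ← lintegral_indicator measurableSet_Icc]
  congr 1
  ext x
  by_cases hx : x ≤ t
  · by_cases h0 : 0 ≤ x
    · rw [Set.indicator_of_mem (Set.mem_Iic.2 hx), Set.indicator_of_mem (Set.mem_Icc.2 ⟨h0, hx⟩),
        Pi.mul_apply, exponentialPDF_of_nonneg h0, ENNReal.ofReal_mul' (hg0 x hx)]
    · rw [Set.indicator_of_mem (Set.mem_Iic.2 hx), Set.indicator_of_notMem (fun h => h0 h.1),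
        Pi.mul_apply, exponentialPDF_of_neg (not_le.1 h0), zero_mul]
  · rw [Set.indicator_of_notMem (mt Set.mem_Iic.1 hx), Set.indicator_of_notMem (fun h => hx h.2)]

lemma expMeasure_Ioi {lam : ℝ} (hlam : 0 < lam) {t : ℝ} (ht : 0 ≤ t) :
    expMeasure lam (Set.Ioi t) = ENNReal.ofReal (Real.exp (-(lam * t))) := by
  have := isProbabilityMeasure_expMeasure hlam
  have h : expMeasure lam (Set.Iic t) = ENNReal.ofReal (1 - Real.exp (-(lam * t))) := by
    change volume.withDensity (exponentialPDF lam) (Set.Iic t) = _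
    rw [withDensity_apply _ measurableSet_Iic, lintegral_exponentialPDF_eq_antiDeriv hlam, if_pos ht]
  have hle : Real.exp (-(lam * t)) ≤ 1 := Real.exp_le_one_iff.2 (by nlinarith)
  rw [← Set.compl_Iic, prob_compl_eq_one_sub measurableSet_Iic, h, ← ENNReal.ofReal_one,
    ← ENNReal.ofReal_sub _ (by linarith)]
  congr 1
  ring

/-- The integral over the time `x` of the first split in the computation of the probability of
a shape with `n + 1` internal nodes. -/
lemma integral_first_split (lam t : ℝ) (n : ℕ) :
    ∫ x in (0 : ℝ)..t, lam * Real.exp (-(lam * x)) * (Real.exp (-(lam * (t - x))) ^ 2 *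
        (1 - Real.exp (-(lam * (t - x)))) ^ n)
      = Real.exp (-(lam * t)) * (1 - Real.exp (-(lam * t))) ^ (n + 1) / (n + 1) := by
  have hE (x : ℝ) : HasDerivAt (fun x => Real.exp (-(lam * (t - x))))
      (Real.exp (-(lam * (t - x))) * lam) x := by
    have h := ((((hasDerivAt_id x).const_sub t).const_mul lam).neg).exp
    simpa using h
  have hd (x : ℝ) : HasDerivAt
      (fun x => -(Real.exp (-(lam * t)) * (1 - Real.exp (-(lam * (t - x)))) ^ (n + 1) / (n + 1)))
      (lam * Real.exp (-(lam * x)) * (Real.exp (-(lam * (t - x))) ^ 2 *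
        (1 - Real.exp (-(lam * (t - x)))) ^ n)) x := by
    have h := (((((hE x).const_sub 1).pow (n + 1)).const_mul (Real.exp (-(lam * t)))).div_const
      ((n : ℝ) + 1)).neg
    have hexp : Real.exp (-(lam * t)) = Real.exp (-(lam * x)) * Real.exp (-(lam * (t - x))) := by
      rw [← Real.exp_add]
      ring_nf
    refine h.congr_deriv ?_
    have : (n : ℝ) + 1 ≠ 0 := by positivity
    rw [hexp]
    push_cast
    field_simp
  rw [intervalIntegral.integral_eq_sub_of_hasDerivAt (fun x _ => hd x)
    (Continuous.intervalIntegrable (by fun_prop) _ _)]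
  simp

/-- The number of internal nodes at time `t` is geometric and, given this number, the shape is that
of a random binary search tree. The factor `1 / (n + 1)` in the weight of a shape with `n + 1`
internal nodes comes from the integration over the time of the first split. -/
lemma lifetimeMeasure_hasShape {lam : ℝ} (hlam : 0 < lam) (τ : BinaryTree Unit) {t : ℝ}
    (ht : 0 ≤ t) : lifetimeMeasure lam {T | HasShape τ T t} = ENNReal.ofReal
      (weight τ * (Real.exp (-(lam * t)) * (1 - Real.exp (-(lam * t))) ^ τ.numNodes)) := by
  have := isProbabilityMeasure_expMeasure hlam
  have := isProbabilityMeasure_lifetimeMeasure hlam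
  induction τ generalizing t with
  | nil =>
    have h : (lifetimeMeasure lam).map (fun T => T []) = expMeasure lam :=
      Measure.infinitePi_map_eval (fun _ => expMeasure lam) []
    have h' : lifetimeMeasure lam {T | HasShape .nil T t} = expMeasure lam (Set.Ioi t) := by
      rw [← h, Measure.map_apply (measurable_pi_apply _) measurableSet_Ioi]
      rfl
    rw [h', expMeasure_Ioi hlam ht]
    simp [weight]
  | node _ l r ihl ihr =>
    set B : Set (ℝ × (List Bool → ℝ) × (List Bool → ℝ)) :=
      {q | q.1 ≤ t ∧ HasShape l q.2.1 (t - q.1) ∧ HasShape r q.2.2 (t - q.1)} with hB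
    have hBm : MeasurableSet B := by
      refine (measurableSet_le measurable_fst measurable_const).inter (.inter ?_ ?_)
      · exact (measurable_snd.fst.prodMk (measurable_const.sub measurable_fst))
          (measurableSet_hasShape l)
      · exact (measurable_snd.snd.prodMk (measurable_const.sub measurable_fst))
          (measurableSet_hasShape r)
    have hpre : {T | HasShape (.node () l r) T t} =
        (fun T => (T [], childLifetimes false T, childLifetimes true T)) ⁻¹' B := rfl
    have hmeas : Measurable fun T : List Bool → ℝ =>
        (T [], childLifetimes false T, childLifetimes true T) :=
      (measurable_pi_apply _).prodMk
        ((measurable_childLifetimes _).prodMk (measurable_childLifetimes _))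
    have hexp_le {s : ℝ} (hs : 0 ≤ s) : 0 ≤ 1 - Real.exp (-(lam * s)) :=
      sub_nonneg.2 (Real.exp_le_one_iff.2 (by nlinarith))
    set n := l.numNodes + r.numNodes with hn
    set c := weight l * weight r with hc
    have hc0 : 0 ≤ c := mul_nonneg (weight_nonneg l) (weight_nonneg r)
    set g : ℝ → ℝ := fun x => c * (Real.exp (-(lam * (t - x))) ^ 2 *
        (1 - Real.exp (-(lam * (t - x)))) ^ n) with hg
    have hg0 : ∀ x ≤ t, 0 ≤ g x := fun x hx => by
      have := hexp_le (sub_nonneg.2 hx)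
      positivity
    have hsec : ∀ x, ((lifetimeMeasure lam).prod (lifetimeMeasure lam)) (Prod.mk x ⁻¹' B)
        = (Set.Iic t).indicator (fun x => ENNReal.ofReal (g x)) x := by
      intro x
      by_cases hx : x ≤ t
      · have h0 : 0 ≤ t - x := sub_nonneg.2 hx
        have hprod : Prod.mk x ⁻¹' B =
            {T | HasShape l T (t - x)} ×ˢ {T | HasShape r T (t - x)} := by
          ext q
          simp [hB, hx]
        have := hexp_le h0
        rw [hprod, Measure.prod_prod, ihl h0, ihr h0, Set.indicator_of_mem (Set.mem_Iic.2 hx),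
          ← ENNReal.ofReal_mul (mul_nonneg (weight_nonneg l) (by positivity))]
        congr 1
        simp only [hg, hc, hn]
        ring
      · have : Prod.mk x ⁻¹' B = ∅ := by
          ext q
          simp [hB, hx]
        rw [this, measure_empty, Set.indicator_of_notMem (mt Set.mem_Iic.1 hx)]
    rw [hpre, ← Measure.map_apply hmeas hBm, map_lifetimeMeasure hlam, Measure.prod_apply hBm,
      lintegral_congr hsec, lintegral_indicator measurableSet_Iic,
      lintegral_expMeasure t (by fun_prop) hg0,
      ← ofReal_integral_eq_lintegral_ofReal]
    · rw [integral_Icc_eq_integral_Ioc, ← intervalIntegral.integral_of_le ht]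
      have : ∀ x, lam * Real.exp (-(lam * x)) * g x = c * (lam * Real.exp (-(lam * x)) *
          (Real.exp (-(lam * (t - x))) ^ 2 * (1 - Real.exp (-(lam * (t - x)))) ^ n)) := fun x => by
        simp only [hg]
        ring
      simp_rw [this]
      rw [intervalIntegral.integral_const_mul, integral_first_split]
      congr 1
      rw [weight, numNodes, hn]
      push_cast
      ring
    · exact (Continuous.continuousOn (by fun_prop)).integrableOn_Icc
    · refine (ae_restrict_iff' measurableSet_Icc).2 (.of_forall fun x hx => ?_)
      have := hg0 x hx.2
      simp only [Pi.zero_apply]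
      positivity

lemma countable_binaryTree : Countable (BinaryTree Unit) := by
  rw [← Set.countable_univ_iff]
  refine (Set.countable_iUnion fun n => (treesOfNumNodesEq n).countable_toSet).mono fun τ _ => ?_
  exact Set.mem_iUnion.2 ⟨_, mem_treesOfNumNodesEq_numNodes τ⟩

lemma tsum_binaryTree (f : BinaryTree Unit → ENNReal) :
    ∑' τ, f τ = ∑' n, ∑ τ ∈ treesOfNumNodesEq n, f τ := by
  rw [← (Equiv.sigmaFiberEquiv (numNodes (α := Unit))).tsum_eq, ENNReal.tsum_sigma']
  congr 1
  ext n
  rw [← Finset.tsum_subtype', ← (Equiv.setCongr (coe_treesOfNumNodesEq n)).symm.tsum_eq]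
  rfl

lemma tsum_ofReal_binaryTree {f : BinaryTree Unit → ℝ} (hf : ∀ τ, 0 ≤ f τ) {S : ℝ}
    (hS : HasSum (fun n => ∑ τ ∈ treesOfNumNodesEq n, f τ) S) :
    ∑' τ, ENNReal.ofReal (f τ) = ENNReal.ofReal S := by
  rw [tsum_binaryTree, ← hS.tsum_eq,
    ENNReal.ofReal_tsum_of_nonneg (fun n => Finset.sum_nonneg fun τ _ => hf τ) hS.summable]
  exact tsum_congr fun n => (ENNReal.ofReal_sum_of_nonneg fun τ _ => hf τ).symm

/-- The sum of the probabilities of the shapes with `n` internal nodes, weighted by `h`. -/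
lemma sum_mul_prob (h : BinaryTree Unit → ℝ) (p x : ℝ) (n : ℕ) :
    ∑ τ ∈ treesOfNumNodesEq n, h τ * (weight τ * (p * x ^ τ.numNodes))
      = p * x ^ n * ∑ τ ∈ treesOfNumNodesEq n, weight τ * h τ := by
  rw [Finset.mul_sum]
  refine Finset.sum_congr rfl fun τ hτ => ?_
  rw [mem_treesOfNumNodesEq.1 hτ]
  ring

lemma measurableSet_setOf_hasShape (τ : BinaryTree Unit) (t : ℝ) :
    MeasurableSet {T : List Bool → ℝ | HasShape τ T t} :=
  (measurable_id.prodMk measurable_const) (measurableSet_hasShape τ)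

lemma disjoint_hasShape (t : ℝ) :
    Pairwise (Function.onFun Disjoint fun τ => {T : List Bool → ℝ | HasShape τ T t}) :=
  fun _ _ hne => Set.disjoint_left.2 fun _ h h' => hne (h.unique h')

/-- Almost surely the tree is finite at time `t`, because the probabilities of the finite shapes
sum up to `1`. -/
lemma ae_exists_hasShape {lam : ℝ} (hlam : 0 < lam) {t : ℝ} (ht : 0 ≤ t) :
    ∀ᵐ T ∂(lifetimeMeasure lam), ∃ τ, HasShape τ T t := by
  have := isProbabilityMeasure_lifetimeMeasure hlam
  have := countable_binaryTree
  have hm : MeasurableSet (⋃ τ, {T : List Bool → ℝ | HasShape τ T t}) :=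
    .iUnion fun τ => measurableSet_setOf_hasShape τ t
  have hp : 0 < Real.exp (-(lam * t)) := Real.exp_pos _
  have hp1 : Real.exp (-(lam * t)) ≤ 1 := Real.exp_le_one_iff.2 (by nlinarith)
  have hx : 0 ≤ 1 - Real.exp (-(lam * t)) := by linarith
  have h1 : lifetimeMeasure lam (⋃ τ, {T | HasShape τ T t}) = 1 := by
    rw [measure_iUnion (disjoint_hasShape t) fun τ => measurableSet_setOf_hasShape τ t]
    simp_rw [lifetimeMeasure_hasShape hlam _ ht]
    rw [tsum_ofReal_binaryTree (S := 1) (fun τ => mul_nonneg (weight_nonneg τ) (by positivity)),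
      ENNReal.ofReal_one]
    have h := (hasSum_geometric_of_lt_one hx (by linarith)).mul_left (Real.exp (-(lam * t)))
    refine hasSum_of_eq h (fun n => ?_) (by field_simp; ring)
    have := sum_mul_prob (fun _ => 1) (Real.exp (-(lam * t))) (1 - Real.exp (-(lam * t))) n
    simpa only [one_mul, mul_one, sum_weight] using this
  have h2 := (prob_compl_eq_zero_iff hm).2 h1
  rw [ae_iff]
  convert h2 using 2
  ext T
  simp

lemma ae_nonneg {lam : ℝ} (hlam : 0 < lam) : ∀ᵐ T ∂(lifetimeMeasure lam), ∀ u, 0 ≤ T u := by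
  have := isProbabilityMeasure_expMeasure hlam
  rw [ae_all_iff]
  intro u
  have h : (lifetimeMeasure lam).map (fun T => T u) = expMeasure lam :=
    Measure.infinitePi_map_eval (fun _ => expMeasure lam) u
  have h1 : expMeasure lam (Set.Iio 0) = 0 := by
    change volume.withDensity (exponentialPDF lam) (Set.Iio 0) = _
    rw [withDensity_apply _ measurableSet_Iio, lintegral_exponentialPDF_of_nonpos le_rfl]
  rw [← h, Measure.map_apply (measurable_pi_apply _) measurableSet_Iio] at h1
  rw [ae_iff]
  simp only [not_le]
  exact h1

/-- Expectation of a functional of the tree at time `t` which is determined by the shape. -/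
lemma integral_of_hasShape {lam : ℝ} (hlam : 0 < lam) {t : ℝ} (ht : 0 ≤ t)
    {f : (List Bool → ℝ) → ℝ} {h : BinaryTree Unit → ℝ} (h0 : ∀ τ, 0 ≤ h τ)
    (hf : ∀ τ T, (∀ u, 0 ≤ T u) → HasShape τ T t → f T = h τ) {S : ℝ}
    (hS : HasSum (fun n => Real.exp (-(lam * t)) * (1 - Real.exp (-(lam * t))) ^ n *
      ∑ τ ∈ treesOfNumNodesEq n, weight τ * h τ) S) :
    Integrable f (lifetimeMeasure lam) ∧ ∫ T, f T ∂(lifetimeMeasure lam) = S := by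
  have := isProbabilityMeasure_lifetimeMeasure hlam
  have := countable_binaryTree
  have hp1 : Real.exp (-(lam * t)) ≤ 1 := Real.exp_le_one_iff.2 (by nlinarith)
  have hx : 0 ≤ 1 - Real.exp (-(lam * t)) := by linarith
  have hcover : (lifetimeMeasure lam).restrict (⋃ τ, {T | HasShape τ T t}) = lifetimeMeasure lam := by
    refine Measure.restrict_eq_self_of_ae_mem ?_
    filter_upwards [ae_exists_hasShape hlam ht] with T hT
    exact Set.mem_iUnion.2 hT
  have hconst (τ : BinaryTree Unit) :
      f =ᵐ[(lifetimeMeasure lam).restrict {T | HasShape τ T t}] fun _ => h τ := by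
    rw [Filter.EventuallyEq, ae_restrict_iff' (measurableSet_setOf_hasShape τ t)]
    filter_upwards [ae_nonneg hlam] with T hT hT'
    exact hf τ T hT hT'
  have hmeas : AEMeasurable f (lifetimeMeasure lam) := by
    rw [← hcover, aemeasurable_iUnion_iff]
    exact fun τ => aemeasurable_const.congr (hconst τ).symm
  have hnn : 0 ≤ᵐ[lifetimeMeasure lam] f := by
    filter_upwards [ae_nonneg hlam, ae_exists_hasShape hlam ht] with T hT hT'
    obtain ⟨τ, hτ⟩ := hT'
    rw [hf τ T hT hτ]
    exact h0 τ
  have hS0 : 0 ≤ S := hS.nonneg fun n => mul_nonneg (by positivity) (Finset.sum_nonneg fun τ _ =>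
    mul_nonneg (weight_nonneg τ) (h0 τ))
  have hint : ∫⁻ T, ENNReal.ofReal (f T) ∂(lifetimeMeasure lam) = ENNReal.ofReal S := by
    conv_lhs => rw [← hcover]
    rw [lintegral_iUnion (fun τ => measurableSet_setOf_hasShape τ t) (disjoint_hasShape t)]
    have hτ (τ : BinaryTree Unit) :
        ∫⁻ T in {T | HasShape τ T t}, ENNReal.ofReal (f T) ∂(lifetimeMeasure lam) =
          ENNReal.ofReal (h τ * (weight τ *
            (Real.exp (-(lam * t)) * (1 - Real.exp (-(lam * t))) ^ τ.numNodes))) := by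
      have : (fun T => ENNReal.ofReal (f T))
          =ᵐ[(lifetimeMeasure lam).restrict {T | HasShape τ T t}] fun _ => ENNReal.ofReal (h τ) :=
        (hconst τ).fun_comp ENNReal.ofReal
      rw [lintegral_congr_ae this, setLIntegral_const, lifetimeMeasure_hasShape hlam τ ht,
        ENNReal.ofReal_mul (h0 τ)]
    simp_rw [hτ]
    refine tsum_ofReal_binaryTree (fun τ => mul_nonneg (h0 τ)
      (mul_nonneg (weight_nonneg τ) (by positivity))) ?_
    simpa only [sum_mul_prob] using hS
  refine ⟨⟨hmeas.aestronglyMeasurable, ?_⟩, ?_⟩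
  · rw [hasFiniteIntegral_iff_ofReal hnn, hint]
    exact ENNReal.ofReal_lt_top
  · rw [integral_eq_lintegral_of_nonneg_ae hnn hmeas.aestronglyMeasurable, hint,
      ENNReal.toReal_ofReal hS0]

/-! ### Moments of the average leaf depth -/

/-- The average depth of the leaves at time `t`. -/
noncomputable def averageDepth (t : ℝ) (T : List Bool → ℝ) : ℝ :=
  (G T t : ℝ) / (Z T t : ℝ)

lemma averageDepth_of_hasShape {τ : BinaryTree Unit} {T : List Bool → ℝ} {t : ℝ} (ht : 0 ≤ t)
    (hT : ∀ u, 0 ≤ T u) (h : HasShape τ T t) :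
    averageDepth t T = (pathLength τ : ℝ) / (τ.numNodes + 1) := by
  obtain ⟨-, hZ, hG⟩ := h.leaves_eq hT ht
  rw [averageDepth, hZ, hG, numLeaves_eq_numNodes_succ]
  push_cast
  rfl

lemma sum_weight_mul_averageDepth (n : ℕ) :
    ∑ τ ∈ treesOfNumNodesEq n, weight τ * ((pathLength τ : ℝ) / (τ.numNodes + 1))
      = 2 * ((harmonic (n + 1) : ℝ) - 1) := by
  have h : ∀ τ ∈ treesOfNumNodesEq n, weight τ * ((pathLength τ : ℝ) / (τ.numNodes + 1))
      = weight τ * pathLength τ / (n + 1) := fun τ hτ => by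
    rw [mem_treesOfNumNodesEq.1 hτ, mul_div_assoc]
  rw [Finset.sum_congr rfl h, ← Finset.sum_div, sum_weight_mul_pathLength]
  field_simp

lemma sum_weight_mul_averageDepth_sq (n : ℕ) :
    ∑ τ ∈ treesOfNumNodesEq n, weight τ * ((pathLength τ : ℝ) / (τ.numNodes + 1)) ^ 2
      = secondMoment n / (n + 1) ^ 2 := by
  have h : ∀ τ ∈ treesOfNumNodesEq n, weight τ * ((pathLength τ : ℝ) / (τ.numNodes + 1)) ^ 2
      = weight τ * (pathLength τ : ℝ) ^ 2 / (n + 1) ^ 2 := fun τ hτ => by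
    rw [mem_treesOfNumNodesEq.1 hτ, div_pow, mul_div_assoc]
  rw [Finset.sum_congr rfl h, ← Finset.sum_div, sum_weight_mul_pathLength_sq]

lemma integral_averageDepth {lam : ℝ} (hlam : 0 < lam) {t : ℝ} (ht : 0 ≤ t) {S : ℝ}
    (hS : HasSum (fun n : ℕ => Real.exp (-(lam * t)) * (1 - Real.exp (-(lam * t))) ^ n *
      (2 * ((harmonic (n + 1) : ℝ) - 1))) S) :
    Integrable (averageDepth t) (lifetimeMeasure lam) ∧
      ∫ T, averageDepth t T ∂(lifetimeMeasure lam) = S :=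
  integral_of_hasShape hlam ht (h := fun τ => (pathLength τ : ℝ) / (τ.numNodes + 1))
    (fun τ => by positivity) (fun _ _ hT h => averageDepth_of_hasShape ht hT h)
    (by simpa only [sum_weight_mul_averageDepth] using hS)

lemma integral_averageDepth_sq {lam : ℝ} (hlam : 0 < lam) {t : ℝ} (ht : 0 ≤ t) {S : ℝ}
    (hS : HasSum (fun n : ℕ => Real.exp (-(lam * t)) * (1 - Real.exp (-(lam * t))) ^ n *
      (secondMoment n / (n + 1) ^ 2)) S) :
    Integrable (fun T => averageDepth t T ^ 2) (lifetimeMeasure lam) ∧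
      ∫ T, averageDepth t T ^ 2 ∂(lifetimeMeasure lam) = S :=
  integral_of_hasShape hlam ht (h := fun τ => ((pathLength τ : ℝ) / (τ.numNodes + 1)) ^ 2)
    (fun τ => by positivity) (fun _ _ hT h => by rw [averageDepth_of_hasShape ht hT h])
    (by simpa only [sum_weight_mul_averageDepth_sq] using hS)

lemma memLp_averageDepth {lam : ℝ} (hlam : 0 < lam) {t : ℝ} (ht : 0 ≤ t) :
    MemLp (averageDepth t) 2 (lifetimeMeasure lam) := by
  have key : ∃ S S', HasSum (fun n : ℕ => Real.exp (-(lam * t)) *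
      (1 - Real.exp (-(lam * t))) ^ n * (2 * ((harmonic (n + 1) : ℝ) - 1))) S ∧
      HasSum (fun n : ℕ => Real.exp (-(lam * t)) * (1 - Real.exp (-(lam * t))) ^ n *
        (secondMoment n / (n + 1) ^ 2)) S' := by
    rcases ht.eq_or_lt with rfl | ht
    · -- At time `0` the tree is the root, and only the terms of index `0` do not vanish.
      refine ⟨_, _, hasSum_single 0 fun n hn => ?_, hasSum_single 0 fun n hn => ?_⟩ <;> simp [hn]
    · have h1 : Real.exp (-(lam * t)) < 1 := Real.exp_lt_one_iff.2 (by nlinarith)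
      have h0 := Real.exp_pos (-(lam * t))
      have hm := hasSum_mean (x := 1 - Real.exp (-(lam * t))) (by linarith) (by linarith)
      obtain ⟨e, -, -, hs⟩ := exists_hasSum_secondMoment (x := 1 - Real.exp (-(lam * t)))
        (by linarith) (by linarith)
      rw [sub_sub_cancel] at hm hs
      exact ⟨_, _, hm, hs⟩
  obtain ⟨S, S', hS, hS'⟩ := key
  exact (memLp_two_iff_integrable_sq (integral_averageDepth hlam ht hS).1.aestronglyMeasurable).2
    (integral_averageDepth_sq hlam ht hS').1

/-- With `y = lam * t` and `p = exp (-y)`, the variance differs from `7` by terms of order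
`y ^ 2 * p`. -/
lemma abs_variance_averageDepth_sub_le {lam : ℝ} (hlam : 0 < lam) {t : ℝ} (ht : 0 < t) :
    |variance (averageDepth t) (lifetimeMeasure lam) - 7| ≤
      Real.exp (-(lam * t)) * (5 * (lam * t) ^ 2 + 3 * (lam * t))
        / (1 - Real.exp (-(lam * t))) ^ 2 := by
  have := isProbabilityMeasure_lifetimeMeasure hlam
  set y := lam * t with hy
  have hy0 : 0 < y := mul_pos hlam ht
  set p := Real.exp (-y) with hp
  have h1 : p < 1 := Real.exp_lt_one_iff.2 (by linarith)
  have h0 : 0 < p := Real.exp_pos _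
  have hlog : Real.log p = -y := Real.log_exp _
  have hm := hasSum_mean (x := 1 - p) (by linarith) (by linarith)
  obtain ⟨e, he0, he1, hs⟩ := exists_hasSum_secondMoment (x := 1 - p) (by linarith) (by linarith)
  rw [sub_sub_cancel, hlog] at hm hs he1
  obtain ⟨-, hE⟩ := integral_averageDepth hlam ht.le hm
  obtain ⟨-, hE2⟩ := integral_averageDepth_sq hlam ht.le hs
  have hx : 0 < 1 - p := by linarith
  have hvar : variance (averageDepth t) (lifetimeMeasure lam) - 7
      = -(p * (4 * y ^ 2 + (1 - p) * e) / (1 - p) ^ 2) := by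
    rw [variance_eq_sub (memLp_averageDepth hlam ht.le)]
    simp only [Pi.pow_apply]
    rw [hE, hE2]
    field_simp
    ring
  have he2 : (1 - p) * e ≤ y ^ 2 + 3 * y := by nlinarith
  rw [hvar, abs_neg, abs_of_nonneg (by positivity)]
  gcongr ?_ * ?_ / _
  linarith

lemma tendsto_variance_averageDepth {lam : ℝ} (hlam : 0 < lam) :
    Tendsto (fun t => variance (averageDepth t) (lifetimeMeasure lam)) atTop (𝓝 7) := by
  have hy : Tendsto (fun t => lam * t) atTop atTop := tendsto_id.const_mul_atTop hlam
  have hlim : Tendsto (fun y : ℝ => Real.exp (-y) * (5 * y ^ 2 + 3 * y) / (1 - Real.exp (-y)) ^ 2)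
      atTop (𝓝 0) := by
    have h2 := Real.tendsto_pow_mul_exp_neg_atTop_nhds_zero 2
    have h1 := Real.tendsto_pow_mul_exp_neg_atTop_nhds_zero 1
    have h0 := Real.tendsto_exp_neg_atTop_nhds_zero
    have h := ((h2.const_mul 5).add (h1.const_mul 3)).div ((h0.const_sub 1).pow 2) (by norm_num)
    simp only [mul_zero, add_zero, sub_zero, zero_div] at h
    refine h.congr fun y => ?_
    simp only [Pi.div_apply]
    ring
  rw [tendsto_iff_norm_sub_tendsto_zero]
  refine squeeze_zero' (.of_forall fun _ => norm_nonneg _) ?_ (hlim.comp hy)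
  filter_upwards [eventually_gt_atTop 0] with t ht
  exact abs_variance_averageDepth_sub_le hlam ht

end YuleTree

theorem theorem1 {Ω : Type*} [MeasurableSpace Ω] (μ : Measure Ω) [IsProbabilityMeasure μ]
    (lam : ℝ) (hlam : 0 < lam) (T : List Bool → Ω → ℝ) (hT : YuleTree.IsLifetimes lam T μ) :
    (∀ t : ℝ, 0 ≤ t →
      (∀ᵐ ω ∂μ, (YuleTree.leaves (fun u => T u ω) t).Finite ∧
        (YuleTree.leaves (fun u => T u ω) t).Nonempty) ∧
      MemLp (fun ω => (YuleTree.G (fun u => T u ω) t : ℝ) / (YuleTree.Z (fun u => T u ω) t : ℝ))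
        2 μ) ∧
    Tendsto
      (fun t : ℝ => variance
        (fun ω => (YuleTree.G (fun u => T u ω) t : ℝ) / (YuleTree.Z (fun u => T u ω) t : ℝ)) μ)
      atTop (𝓝 7) := by
  have hmeas : AEMeasurable (fun ω u => T u ω) μ :=
    aemeasurable_pi_iff.2 fun u => (hT.hasLaw u).aemeasurable
  have hlaw : μ.map (fun ω u => T u ω) = YuleTree.lifetimeMeasure lam :=
    (hT.indep.hasLaw_infinitePi hT.hasLaw hmeas).map_eq
  have hLp {t : ℝ} (ht : 0 ≤ t) :
      MemLp (YuleTree.averageDepth t) 2 (μ.map fun ω u => T u ω) :=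
    hlaw ▸ YuleTree.memLp_averageDepth hlam ht
  refine ⟨fun t ht => ⟨?_, ?_⟩, ?_⟩
  · have h : ∀ᵐ S ∂(μ.map fun ω u => T u ω),
        (YuleTree.leaves S t).Finite ∧ (YuleTree.leaves S t).Nonempty := by
      rw [hlaw]
      filter_upwards [YuleTree.ae_nonneg hlam, YuleTree.ae_exists_hasShape hlam ht] with S hS hS'
      obtain ⟨τ, hτ⟩ := hS'
      obtain ⟨hfin, hZ, -⟩ := hτ.leaves_eq hS ht
      refine ⟨hfin, Set.nonempty_of_ncard_ne_zero ?_⟩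
      exact (hZ.trans_gt τ.numLeaves_pos).ne'
    exact ae_of_ae_map hmeas h
  · exact (hLp ht).comp_of_map hmeas
  · refine (YuleTree.tendsto_variance_averageDepth hlam).congr' ?_
    filter_upwards [eventually_ge_atTop 0] with t ht
    rw [← hlaw, variance_map (hLp ht).aemeasurable hmeas]
    rfl
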